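/- Let $k\in\mathbb N$ and let $\mathcal S_1,\dots,\mathcal S_k$ be operator systems, that is, selfadjoint linear subspaces $\mathcal S_j\subseteq\mathcal B(H_j)$ ($H_j$ a Hilbert space) containing the identity. For each $j$ let $(C^*_u(\mathcal S_j),\iota_j)$ be the universal $C^*$-cover of $\mathcal S_j$: $C^*_u(\mathcal S_j)$ is a unital $C^*$-algebra, $\iota_j:\mathcal S_j\to C^*_u(\mathcal S_j)$ is a unital complete order embedding whose range generates $C^*_u(\mathcal S_j)$ as a $C^*$-algebra, and for every unital completely positive map $\phi:\mathcal S_j\to\mathcal B(K)$, $K$ a Hilbert space, there is a $*$-representation $\pi$ of $C^*_u(\mathcal S_j)$ on $K$ with $\pi\circ\iota_j=\phi$. Let $\mathrm{max}\text{-}\otimes_{j=1}^kC^*_u(\mathcal S_j)$ be the maximal $C^*$-tensor product, i.e. the completion of the algebraic tensor product in the norm $\|x\|_{\max}=\sup\|(\pi_1\cdots\pi_k)(x)\|$, the supremum being over all families of unital $*$-representations $\pi_j:C^*_u(\mathcal S_j)\to\mathcal B(K)$ on a common Hilbert space $K$ with mutually commuting ranges. Let $\mathrm{c}\text{-}\otimes_{j=1}^k\mathcal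 S_j$ be the commuting tensor product, i.e. the algebraic tensor product $\otimes_{j=1}^k\mathcal S_j$ with the matricial cones in which $u\in M_n(\otimes_{j=1}^k\mathcal S_j)$ is positive if and only if $(\phi_1\cdots\phi_k)^{(n)}(u)\ge 0$ for all Hilbert spaces $K$ and all completely positive maps $\phi_j:\mathcal S_j\to\mathcal B(K)$, $j=1,\dots,k$, with mutually commuting ranges, where $(\phi_1\cdots\phi_k)(x_1\otimes\cdots\otimes x_k)=\phi_1(x_1)\cdots\phi_k(x_k)$. Then the canonical linear map $\otimes_{j=1}^k\mathcal S_j\to\mathrm{max}\text{-}\otimes_{j=1}^kC^*_u(\mathcal S_j)$, $x_1\otimes\cdots\otimes x_k\mapsto\iota_1(x_1)\otimes\cdots\otimes\iota_k(x_k)$, is injective, and the operator system structure that $\otimes_{j=1}^k\mathcal S_j$ inherits through this inclusion coincides with $\mathrm{c}\text{-}\otimes_{j=1}^k\mathcal S_j$: for every $n$, an element of $M_n(\otimes_{j=1}^k\mathcal S_j)$ is positive in $M_n(\mathrm{c}\text{-}\otimes_{j=1}^k\mathcal S_j)$ if and only if its image in $M_n(\mathrm{max}\text{-}\otimes_{j=1}^kC^*_u(\mathcal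 S_j))$ is positive. -/

import Mathlib

open scoped TensorProduct ENNReal

universe u

namespace OpSys

/-! ### Positivity of matrices, operator systems, completely positive maps -/

/-- Positivity in the `*`-algebra `M_n(A)`. When `A` is a C*-algebra, so is `M_n(A)`, and its
positive elements are precisely those of the form `b* b`. -/
def IsMatrixPositive {A : Type*} [Ring A] [StarRing A] {n : ℕ}
    (a : Matrix (Fin n) (Fin n) A) : Prop :=
  ∃ b : Matrix (Fin n) (Fin n) A, a = star b * b

/-- An operator system in `B(H)`: a selfadjoint linear subspace containing the identity. -/
structure OperatorSystem (H : Type*) [NormedAddCommGroup H] [InnerProductSpace ℂ H]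
    [CompleteSpace H] extends Submodule ℂ (H →L[ℂ] H) where
  one_mem' : (1 : H →L[ℂ] H) ∈ carrier
  star_mem' : ∀ {a : H →L[ℂ] H}, a ∈ carrier → star a ∈ carrier

namespace OperatorSystem

variable {H : Type*} [NormedAddCommGroup H] [InnerProductSpace ℂ H] [CompleteSpace H]

/-- The underlying vector space of an operator system. -/
abbrev Carrier (S : OperatorSystem H) : Type _ := S.toSubmodule

/-- The unit of an operator system. -/
def unit (S : OperatorSystem H) : S.Carrier := ⟨1, S.one_mem'⟩

/-- The cone `M_n(S)⁺ = M_n(S) ∩ M_n(B(H))⁺`. -/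
def cone (S : OperatorSystem H) (n : ℕ) : Set (Matrix (Fin n) (Fin n) S.Carrier) :=
  {x | IsMatrixPositive (x.map fun s => (s : H →L[ℂ] H))}

/-- Complete positivity of a linear map from an operator system to a C*-algebra:
`φ⁽ⁿ⁾` maps `M_n(S)⁺` into `M_n(A)⁺` for every `n`. -/
def IsCompletelyPositive (S : OperatorSystem H) {A : Type*} [CStarAlgebra A]
    (φ : S.Carrier →ₗ[ℂ] A) : Prop :=
  ∀ (n : ℕ), ∀ x ∈ S.cone n, IsMatrixPositive (x.map φ)

/-- Unital complete order embedding of an operator system into a unital C*-algebra. -/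
structure IsUnitalCompleteOrderEmbedding (S : OperatorSystem H) {A : Type*} [CStarAlgebra A]
    (ι : S.Carrier →ₗ[ℂ] A) : Prop where
  map_unit : ι S.unit = 1
  injective : Function.Injective ι
  mem_cone_iff : ∀ (n : ℕ) (x : Matrix (Fin n) (Fin n) S.Carrier),
    x ∈ S.cone n ↔ IsMatrixPositive (x.map ι)

end OperatorSystem

/-- `(A, ι)` is the universal C*-cover of the operator system `S`: `ι` is a unital complete order
embedding whose range generates `A` as a C*-algebra, and every unital completely positive map from
`S` to some `B(K)` extends along `ι` to a `*`-representation of `A`. -/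
structure IsUniversalCStarCover {H : Type u} [NormedAddCommGroup H] [InnerProductSpace ℂ H]
    [CompleteSpace H] (S : OperatorSystem H) {A : Type*} [CStarAlgebra A]
    (ι : S.Carrier →ₗ[ℂ] A) : Prop where
  embedding : S.IsUnitalCompleteOrderEmbedding ι
  generates : (StarAlgebra.adjoin ℂ (Set.range ι)).topologicalClosure = ⊤
  extends_ucp : ∀ (K : Type u) [NormedAddCommGroup K] [InnerProductSpace ℂ K] [CompleteSpace K]
    (φ : S.Carrier →ₗ[ℂ] (K →L[ℂ] K)), S.IsCompletelyPositive φ → φ S.unit = 1 →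
    ∃ π : A →⋆ₐ[ℂ] (K →L[ℂ] K), ∀ s, π (ι s) = φ s

/-! ### Products of commuting maps -/

section Product

variable {k : ℕ}

/-- For linear maps `φ_j : V_j → B` into an algebra, the linear map
`v₁ ⊗ ⋯ ⊗ v_k ↦ φ₁(v₁) ⋯ φ_k(v_k)` on the algebraic tensor product. -/
noncomputable def prodMap {V : Fin k → Type*} [∀ j, AddCommGroup (V j)] [∀ j, Module ℂ (V j)]
    {B : Type*} [Ring B] [Algebra ℂ B] (φ : ∀ j, V j →ₗ[ℂ] B) : (⨂[ℂ] j, V j) →ₗ[ℂ] B :=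
  PiTensorProduct.lift ((MultilinearMap.mkPiAlgebraFin ℂ k B).compLinearMap φ)

theorem prodMap_tprod {V : Fin k → Type*} [∀ j, AddCommGroup (V j)] [∀ j, Module ℂ (V j)]
    {B : Type*} [Ring B] [Algebra ℂ B] (φ : ∀ j, V j →ₗ[ℂ] B) (v : ∀ j, V j) :
    prodMap φ (PiTensorProduct.tprod ℂ v) = (List.ofFn fun j => φ j (v j)).prod := by
  simp [prodMap]

/-- The maps `φ_j` have mutually commuting ranges. -/
def CommutingRanges {V : Fin k → Type*} {B : Type*} [Mul B] (φ : ∀ j, V j → B) : Prop :=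
  ∀ i j, i ≠ j → ∀ a b, Commute (φ i a) (φ j b)

end Product

/-! ### The multivariate commuting tensor product of operator systems -/

/-- A family of matricial cones on a vector space `V`: a subset of `M_n(V)` for each `n`. -/
abbrev MatricialCones (V : Type*) : Type _ := ∀ n : ℕ, Set (Matrix (Fin n) (Fin n) V)

/-- The matricial cones of `c-⊗ S_j` on the algebraic tensor product: `u ∈ M_n(⊗ S_j)` is positive
if `(φ₁ ⋯ φ_k)⁽ⁿ⁾(u) ≥ 0` for all Hilbert spaces `K` and all completely positive maps
`φ_j : S_j → B(K)` with mutually commuting ranges. -/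
def commutingCones {k : ℕ} {H : Fin k → Type u} [∀ j, NormedAddCommGroup (H j)]
    [∀ j, InnerProductSpace ℂ (H j)] [∀ j, CompleteSpace (H j)] (S : ∀ j, OperatorSystem (H j)) :
    MatricialCones (⨂[ℂ] j, (S j).Carrier) := fun _ =>
  {x | ∀ (K : Type u) [NormedAddCommGroup K] [InnerProductSpace ℂ K] [CompleteSpace K]
    (φ : ∀ j, (S j).Carrier →ₗ[ℂ] (K →L[ℂ] K)), (∀ j, (S j).IsCompletelyPositive (φ j)) →
    CommutingRanges (fun j => φ j) → IsMatrixPositive (x.map (prodMap φ))}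

/-! ### The maximal tensor product of unital C*-algebras -/

noncomputable instance lpCStarAlgebra {I : Type*} (B : I → Type*) [∀ i, CStarAlgebra (B i)]
    [∀ i, Nontrivial (B i)] : CStarAlgebra (lp B ∞) where

section Max

variable {k : ℕ} (A : Fin k → Type u) [∀ j, CStarAlgebra (A j)]

/-- Commuting unital `*`-representations of `A₁, …, A_k` on one nonzero Hilbert space. -/
structure CommutingRep where
  /-- The Hilbert space. -/
  K : Type u
  [normedAddCommGroup : NormedAddCommGroup K]
  [innerProductSpace : InnerProductSpace ℂ K]
  [completeSpace : CompleteSpace K]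
  [nontrivial : Nontrivial K]
  /-- The representations. -/
  π : ∀ j, A j →⋆ₐ[ℂ] (K →L[ℂ] K)
  commuting : CommutingRanges fun j => π j

attribute [instance] CommutingRep.normedAddCommGroup CommutingRep.innerProductSpace
  CommutingRep.completeSpace CommutingRep.nontrivial

/-- The C*-algebraic direct product `∏ B(K_ρ)` (bounded families, supremum norm) over all commuting
families `ρ` of representations. -/
abbrev RepProduct : Type (u + 1) := lp (fun ρ : CommutingRep A => ρ.K →L[ℂ] ρ.K) ∞

variable {A}

/-- The `*`-homomorphism `A_j → ∏ B(K_ρ)`, `a ↦ (ρ_j(a))_ρ`. -/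
noncomputable def repHom (j : Fin k) : A j →⋆ₐ[ℂ] RepProduct A where
  toFun a := ⟨fun ρ => ρ.π j a, memℓp_infty ⟨‖a‖, by
    rintro _ ⟨ρ, rfl⟩
    exact NonUnitalStarAlgHom.norm_apply_le (ρ.π j) a⟩⟩
  map_one' := by ext1; funext ρ; exact map_one (ρ.π j)
  map_mul' a b := by ext1; funext ρ; exact map_mul (ρ.π j) a b
  map_zero' := by ext1; funext ρ; exact map_zero (ρ.π j)
  map_add' a b := by ext1; funext ρ; exact map_add (ρ.π j) a b
  commutes' c := by ext1; funext ρ; exact AlgHomClass.commutes (ρ.π j) c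
  map_star' a := by ext1; funext ρ; exact map_star (ρ.π j) a

variable (A)

/-- The maximal C*-tensor product `max-⊗ A_j`: the closure of the image of the algebraic tensor
product under all commuting families of representations, i.e. its completion in the norm
`‖x‖ = sup_ρ ‖(ρ₁ ⋯ ρ_k)(x)‖`. It is realized as the C*-subalgebra of `∏ B(K_ρ)` generated by the
images of the `A_j`. -/
noncomputable def maxTensor : StarSubalgebra ℂ (RepProduct A) :=
  (StarAlgebra.adjoin ℂ (⋃ j, Set.range (repHom (A := A) j))).topologicalClosure

noncomputable instance : CStarAlgebra (maxTensor A) :=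
  haveI : IsClosed (maxTensor A : Set (RepProduct A)) :=
    StarSubalgebra.isClosed_topologicalClosure _
  StarSubalgebra.cstarAlgebra _

variable {A}

/-- The canonical `*`-homomorphism `A_j → max-⊗ A_i`. -/
noncomputable def maxInclusion (j : Fin k) : A j →⋆ₐ[ℂ] maxTensor A :=
  (repHom j).codRestrict _ fun a => StarSubalgebra.le_topologicalClosure _
    (StarAlgebra.subset_adjoin ℂ _ (Set.mem_iUnion.2 ⟨j, a, rfl⟩))

end Max

/-! ### The structure induced from the maximal tensor product -/

section Induced

variable {k : ℕ} {V : Fin k → Type*} [∀ j, AddCommGroup (V j)] [∀ j, Module ℂ (V j)]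
  {A : Fin k → Type u} [∀ j, CStarAlgebra (A j)]

/-- The canonical linear map `⊗ V_j → max-⊗ A_j` determined by linear maps `ι_j : V_j → A_j`; it
sends `v₁ ⊗ ⋯ ⊗ v_k` to `ι₁(v₁) ⊗ ⋯ ⊗ ι_k(v_k)`. -/
noncomputable def toMaxTensor (ι : ∀ j, V j →ₗ[ℂ] A j) : (⨂[ℂ] j, V j) →ₗ[ℂ] maxTensor A :=
  prodMap fun j => (maxInclusion j).toAlgHom.toLinearMap ∘ₗ ι j

/-- The matricial cones on `⊗ V_j` inherited from `max-⊗ A_j`. -/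
def inducedCones (ι : ∀ j, V j →ₗ[ℂ] A j) : MatricialCones (⨂[ℂ] j, V j) := fun _ =>
  {x | IsMatrixPositive (x.map (toMaxTensor ι))}

end Induced

/-! ### Existence of the universal C*-cover

The facts below show that `IsUniversalCStarCover` is satisfiable for every operator system. -/

theorem nonneg_iff_exists_star_mul_self {A : Type*} [CStarAlgebra A] [PartialOrder A]
    [StarOrderedRing A] (a : A) : 0 ≤ a ↔ ∃ b, a = star b * b :=
  CStarAlgebra.nonneg_iff_eq_star_mul_self

theorem isMatrixPositive_iff {A : Type*} [CStarAlgebra A] [PartialOrder A] [StarOrderedRing A]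
    {n : ℕ} (a : Matrix (Fin n) (Fin n) A) :
    IsMatrixPositive a ↔ 0 ≤ CStarMatrix.ofMatrix a :=
  (nonneg_iff_exists_star_mul_self (A := CStarMatrix (Fin n) (Fin n) A) a).symm

theorem nonneg_of_forall_map_nonneg {T : Type*} [CStarAlgebra T] [PartialOrder T]
    [StarOrderedRing T] {I : Type*} {R : I → Type*} [∀ i, CStarAlgebra (R i)]
    [∀ i, PartialOrder (R i)] [∀ i, StarOrderedRing (R i)] (Ψ : ∀ i, T →⋆ₙₐ[ℂ] R i)
    (hΨ : ∀ y, (∀ i, Ψ i y = 0) → y = 0) (x : T) (hΨx : ∀ i, 0 ≤ Ψ i x) : 0 ≤ x := by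
  have hsa : IsSelfAdjoint x := by
    rw [IsSelfAdjoint, ← sub_eq_zero]
    refine hΨ _ fun i => ?_
    rw [map_sub, map_star, (IsSelfAdjoint.of_nonneg (hΨx i)).star_eq, sub_self]
  rw [← CFC.negPart_eq_zero_iff x hsa]
  have hneg : IsSelfAdjoint (x⁻) := IsSelfAdjoint.of_nonneg (CFC.negPart_nonneg x)
  have h1 : x⁻ * x * x⁻ = -(x⁻ * x⁻ * x⁻) := by
    have h0 : x⁻ * (x⁺ - x⁻) * x⁻ = -(x⁻ * x⁻ * x⁻) := by
      rw [mul_sub, CFC.negPart_mul_posPart, zero_sub, neg_mul]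
    rwa [CFC.posPart_sub_negPart x hsa] at h0
  have h3 : x⁻ * x⁻ * x⁻ = 0 := by
    refine hΨ _ fun i => le_antisymm ?_ ?_
    · rw [← neg_nonneg, ← map_neg, ← h1, map_mul, map_mul]
      exact (hneg.map (Ψ i)).conjugate_nonneg (hΨx i)
    · rw [map_mul, map_mul]
      refine (hneg.map (Ψ i)).conjugate_nonneg ?_
      obtain ⟨c, hc⟩ := CStarAlgebra.nonneg_iff_eq_star_mul_self.1 (CFC.negPart_nonneg x)
      rw [hc, map_mul, map_star]
      exact star_mul_self_nonneg _
  have h4 : x⁻ * x⁻ = 0 := by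
    rw [← CStarRing.star_mul_self_eq_zero_iff, star_mul, hneg.star_eq, ← mul_assoc, h3, zero_mul]
  rwa [← CStarRing.star_mul_self_eq_zero_iff, hneg.star_eq]
theorem IsMatrixPositive.map {A B : Type*} [CStarAlgebra A] [CStarAlgebra B] (π : A →⋆ₐ[ℂ] B)
    {n : ℕ} {a : Matrix (Fin n) (Fin n) A} (h : IsMatrixPositive a) :
    IsMatrixPositive (a.map π) := by
  obtain ⟨b, rfl⟩ := h
  refine ⟨b.map π, ?_⟩
  ext i j
  simp [Matrix.mul_apply, Matrix.star_apply, map_star]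

theorem isMatrixPositive_of_forall {A : Type*} [CStarAlgebra A] {I : Type*} {B : I → Type*}
    [∀ i, CStarAlgebra (B i)] (π : ∀ i, A →⋆ₐ[ℂ] B i) (hπ : ∀ a, (∀ i, π i a = 0) → a = 0)
    {n : ℕ} (a : Matrix (Fin n) (Fin n) A) (ha : ∀ i, IsMatrixPositive (a.map (π i))) :
    IsMatrixPositive a := by
  let := CStarAlgebra.spectralOrder A
  have := CStarAlgebra.spectralOrderedRing A
  let := fun i => CStarAlgebra.spectralOrder (B i)
  have := fun i => CStarAlgebra.spectralOrderedRing (B i)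
  rw [isMatrixPositive_iff]
  set x : CStarMatrix (Fin n) (Fin n) A := CStarMatrix.ofMatrix a with hx
  let Ψ (i : I) : CStarMatrix (Fin n) (Fin n) A →⋆ₙₐ[ℂ] CStarMatrix (Fin n) (Fin n) (B i) :=
    CStarMatrix.mapₙₐ (π i : A →⋆ₙₐ[ℂ] B i)
  have hΨ : ∀ y, (∀ i, Ψ i y = 0) → y = 0 := fun y hy => by
    ext p q
    exact hπ _ fun i => congrFun (congrFun (hy i) p) q
  exact nonneg_of_forall_map_nonneg Ψ hΨ x fun i => (isMatrixPositive_iff _).1 (ha i)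

/-- A C*-algebra generated by a family indexed by a type in a universe is small for that universe. -/
theorem small_closure_adjoin {A : Type*} [CStarAlgebra A] {X : Type u} (f : X → A) :
    Small.{u} (StarAlgebra.adjoin ℂ (Set.range f)).topologicalClosure := by
  have h0 : Small.{u} (StarAlgebra.adjoin ℂ (Set.range f) : Set A) := by
    let g : X ⊕ X → A := Sum.elim f (fun x => star (f x))
    have : (StarAlgebra.adjoin ℂ (Set.range f) : Set A) = Set.range (FreeAlgebra.lift ℂ g) := by
      rw [← StarSubalgebra.coe_toSubalgebra, StarAlgebra.adjoin_toSubalgebra, ← AlgHom.coe_range,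
        ← Algebra.adjoin_range_eq_range_freeAlgebra_lift]
      congr 2
      simp only [g, Set.Sum.elim_range]
      congr 1
      ext a
      constructor
      · rintro ⟨x, hx⟩
        exact ⟨x, by simp [hx]⟩
      · rintro ⟨x, rfl⟩
        exact ⟨x, by simp⟩
    rw [this]
    infer_instance
  have h1 : ∀ a : (StarAlgebra.adjoin ℂ (Set.range f)).topologicalClosure,
      ∃ s : ℕ → (StarAlgebra.adjoin ℂ (Set.range f) : Set A),
        Filter.Tendsto (fun n => (s n : A)) Filter.atTop (nhds (a : A)) := fun a => by
    have : (a : A) ∈ closure (StarAlgebra.adjoin ℂ (Set.range f) : Set A) := a.2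
    obtain ⟨s, hs, hlim⟩ := mem_closure_iff_seq_limit.1 this
    exact ⟨fun n => ⟨s n, hs n⟩, hlim⟩
  choose s hs using h1
  refine small_of_injective (f := s) fun a b hab => Subtype.ext ?_
  have := hs b
  rw [← hab] at this
  exact tendsto_nhds_unique (hs a) this

theorem exists_shrink (A : Type*) [CStarAlgebra A] [Small.{u} A] :
    ∃ (A' : Type u) (_ : CStarAlgebra A') (f : A →⋆ₐ[ℂ] A') (g : A' →⋆ₐ[ℂ] A),
      (∀ a, f (g a) = a) ∧ ∀ a, g (f a) = a := by
  let e : Shrink.{u} A ≃ A := (equivShrink A).symm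
  let : NormedRing (Shrink.{u} A) := e.normedRing
  let : Algebra ℂ (Shrink.{u} A) := e.algebra ℂ
  let : NormedAlgebra ℂ (Shrink.{u} A) := NormedAlgebra.induced ℂ _ _ (e.algEquiv ℂ).toAlgHom
  have hmul (a b) : e (a * b) = e a * e b := map_mul e.ringEquiv a b
  have hadd (a b) : e (a + b) = e a + e b := map_add e.ringEquiv a b
  have hsmul (c : ℂ) (a) : e (c • a) = c • e a := map_smul (e.algEquiv ℂ) c a
  have hnorm (a : Shrink.{u} A) : ‖a‖ = ‖e a‖ := rfl
  let : StarRing (Shrink.{u} A) :=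
    { star := fun a => e.symm (star (e a))
      star_involutive := fun a => by simp
      star_mul := fun a b => by apply e.injective; simp [hmul]
      star_add := fun a b => by apply e.injective; simp [hadd] }
  have hstar (a : Shrink.{u} A) : e (star a) = star (e a) := e.apply_symm_apply _
  have : CompleteSpace (Shrink.{u} A) := by
    have hiso : Isometry e := AddMonoidHomClass.isometry_of_norm e.ringEquiv fun a => rfl
    exact (IsometryEquiv.mk e hiso).completeSpace
  have : CStarRing (Shrink.{u} A) :=
    ⟨fun a => by simp only [hnorm, hmul, hstar]; exact CStarRing.norm_mul_self_le _⟩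
  have : StarModule ℂ (Shrink.{u} A) :=
    ⟨fun c a => by apply e.injective; simp [hsmul, hstar]⟩
  have hone : e 1 = 1 := map_one e.ringEquiv
  have hzero : e 0 = 0 := map_zero e.ringEquiv
  have halg (c : ℂ) : e (algebraMap ℂ _ c) = algebraMap ℂ A c := (e.algEquiv ℂ).commutes c
  refine ⟨Shrink.{u} A, { },
    { toFun := e.symm
      map_one' := by apply e.injective; simp [hone]
      map_mul' := fun a b => by apply e.injective; simp [hmul]
      map_zero' := by apply e.injective; simp [hzero]
      map_add' := fun a b => by apply e.injective; simp [hadd]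
      commutes' := fun c => by apply e.injective; simp [halg]
      map_star' := fun a => by apply e.injective; simp [hstar] },
    { toFun := e, map_one' := hone, map_mul' := hmul, map_zero' := hzero, map_add' := hadd,
      commutes' := halg, map_star' := hstar },
    fun a => e.symm_apply_apply a, fun a => e.apply_symm_apply a⟩

section Existence

variable {H : Type u} [NormedAddCommGroup H] [InnerProductSpace ℂ H] [CompleteSpace H]
  (S : OperatorSystem H)

theorem OperatorSystem.IsCompletelyPositive.map_nonneg {S : OperatorSystem H} {K : Type*}
    [NormedAddCommGroup K] [InnerProductSpace ℂ K] [CompleteSpace K]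
    {φ : S.Carrier →ₗ[ℂ] (K →L[ℂ] K)} (hφ : S.IsCompletelyPositive φ) (p : S.Carrier)
    (hp : (0 : H →L[ℂ] H) ≤ p) : 0 ≤ φ p := by
  obtain ⟨c, hc⟩ := (nonneg_iff_exists_star_mul_self _).1 hp
  obtain ⟨b, hb⟩ := hφ 1 (Matrix.of fun _ _ => p) ⟨Matrix.of fun _ _ => c, by
    ext1 i j
    simp [Matrix.mul_apply, Matrix.star_apply, hc]⟩
  refine (nonneg_iff_exists_star_mul_self _).2 ⟨b 0 0, ?_⟩
  have := congrFun (congrFun hb 0) 0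
  simpa [Matrix.mul_apply, Matrix.star_apply] using this

theorem OperatorSystem.IsCompletelyPositive.norm_le {S : OperatorSystem H} {K : Type*}
    [NormedAddCommGroup K] [InnerProductSpace ℂ K] [CompleteSpace K]
    {φ : S.Carrier →ₗ[ℂ] (K →L[ℂ] K)} (hφ : S.IsCompletelyPositive φ) (h1 : φ S.unit = 1)
    (h : S.Carrier) (hh : IsSelfAdjoint (h : H →L[ℂ] H)) :
    ‖φ h‖ ≤ ‖h‖ * ‖(1 : K →L[ℂ] K)‖ * 3 := by
  set r : ℝ := ‖(h : H →L[ℂ] H)‖ with hr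
  have hr0 : 0 ≤ r := norm_nonneg _
  have hsm : ∀ (B : Type _) [CStarAlgebra B], algebraMap ℝ B r = (r : ℂ) • (1 : B) := fun B _ => by
    rw [Algebra.algebraMap_eq_smul_one, Complex.coe_smul]
  have hp1 : 0 ≤ φ ((r : ℂ) • S.unit + h) := hφ.map_nonneg _ (by
    have := hh.neg_algebraMap_norm_le_self
    rw [hsm, neg_le_iff_add_nonneg'] at this
    exact this)
  have hp2 : 0 ≤ φ ((r : ℂ) • S.unit - h) := hφ.map_nonneg _ (by
    have := hh.le_algebraMap_norm_self
    rw [hsm, ← sub_nonneg] at this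
    exact this)
  rw [map_add, map_smul, h1] at hp1
  rw [map_sub, map_smul, h1] at hp2
  have hle : (r : ℂ) • (1 : K →L[ℂ] K) + φ h ≤ (r : ℂ) • 1 + (r : ℂ) • 1 :=
    add_le_add_right (sub_nonneg.1 hp2) _
  have hn := CStarAlgebra.norm_le_norm_of_nonneg_of_le hp1 hle
  have e1 : ‖(r : ℂ) • (1 : K →L[ℂ] K)‖ = r * ‖(1 : K →L[ℂ] K)‖ := by
    rw [norm_smul, Complex.norm_real, Real.norm_of_nonneg hr0]
  have e2 : ‖φ h‖ ≤ ‖(r : ℂ) • (1 : K →L[ℂ] K) + φ h‖ + ‖(r : ℂ) • (1 : K →L[ℂ] K)‖ := by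
    simpa using norm_sub_le ((r : ℂ) • (1 : K →L[ℂ] K) + φ h) ((r : ℂ) • (1 : K →L[ℂ] K))
  have e3 := norm_add_le ((r : ℂ) • (1 : K →L[ℂ] K)) ((r : ℂ) • 1)
  change ‖φ h‖ ≤ r * _ * 3
  linarith

/-- A unital completely positive map into some `B(K)`, `K ≠ 0`. -/
structure UcpMap where
  /-- The Hilbert space. -/
  K : Type u
  [normedAddCommGroup : NormedAddCommGroup K]
  [innerProductSpace : InnerProductSpace ℂ K]
  [completeSpace : CompleteSpace K]
  [nontrivial : Nontrivial K]
  /-- The map. -/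
  φ : S.Carrier →ₗ[ℂ] (K →L[ℂ] K)
  cp : S.IsCompletelyPositive φ
  unital : φ S.unit = 1

attribute [instance] UcpMap.normedAddCommGroup UcpMap.innerProductSpace
  UcpMap.completeSpace UcpMap.nontrivial

theorem UcpMap.bounded (s : S.Carrier) : BddAbove (Set.range fun ρ : UcpMap S => ‖ρ.φ s‖) := by
  let t : S.Carrier := ⟨star s, S.star_mem' s.2⟩
  let a : S.Carrier := s + t
  let b : S.Carrier := Complex.I • (s - t)
  have ha : IsSelfAdjoint (a : H →L[ℂ] H) := by
    simp [a, t, IsSelfAdjoint, add_comm]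
  have hb : IsSelfAdjoint (b : H →L[ℂ] H) := by
    simp [b, t, IsSelfAdjoint, ← smul_neg]
  have hs : s = (2⁻¹ : ℂ) • (a - Complex.I • b) := by
    simp only [a, b, smul_smul, Complex.I_mul_I]
    module
  refine ⟨‖(2⁻¹ : ℂ)‖ * (‖a‖ * 1 * 3 + ‖Complex.I‖ * (‖b‖ * 1 * 3)), ?_⟩
  rintro _ ⟨ρ, rfl⟩
  have h1 := ρ.cp.norm_le ρ.unital a ha
  have h2 := ρ.cp.norm_le ρ.unital b hb
  rw [norm_one] at h1 h2
  dsimp only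
  conv_lhs => rw [hs]
  rw [map_smul, map_sub, map_smul, norm_smul]
  gcongr
  refine (norm_sub_le _ _).trans ?_
  rw [norm_smul]
  gcongr

/-- The map `s ↦ (φ(s))_φ` into the C*-product over all unital completely positive maps. -/
noncomputable def ucpProd : S.Carrier →ₗ[ℂ] lp (fun ρ : UcpMap S => ρ.K →L[ℂ] ρ.K) ∞ where
  toFun s := ⟨fun ρ => ρ.φ s, memℓp_infty (UcpMap.bounded S s)⟩
  map_add' s t := by ext1; funext ρ; exact map_add ρ.φ s t
  map_smul' c s := by ext1; funext ρ; exact map_smul ρ.φ c s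

/-- Evaluation of the C*-product at a coordinate. -/
noncomputable def lpEval {I : Type*} (B : I → Type*) [∀ i, CStarAlgebra (B i)]
    [∀ i, Nontrivial (B i)] (i : I) : lp B ∞ →⋆ₐ[ℂ] B i where
  toFun f := f i
  map_one' := rfl
  map_mul' _ _ := rfl
  map_zero' := rfl
  map_add' _ _ := rfl
  commutes' _ := rfl
  map_star' _ := rfl

theorem adjoin_codRestrict_eq_top {B : Type*} [CStarAlgebra B] {X : Type*} (f : X → B)
    (M : StarSubalgebra ℂ B) (hM : M = (StarAlgebra.adjoin ℂ (Set.range f)).topologicalClosure)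
    (f' : X → M) (hf : ∀ x, (f' x : B) = f x) :
    (StarAlgebra.adjoin ℂ (Set.range f')).topologicalClosure = ⊤ := by
  rw [eq_top_iff]
  intro x _
  change x ∈ closure (StarAlgebra.adjoin ℂ (Set.range f') : Set M)
  rw [closure_subtype]
  have h1 : (StarAlgebra.adjoin ℂ (Set.range f')).map M.subtype =
      StarAlgebra.adjoin ℂ (Set.range f) := by
    rw [StarAlgHom.map_adjoin, ← Set.range_comp]
    congr 2
    funext y
    exact hf y
  have h2 : (Subtype.val '' (StarAlgebra.adjoin ℂ (Set.range f') : Set M)) =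
      (StarAlgebra.adjoin ℂ (Set.range f) : Set B) := by
    rw [← h1]
    rfl
  rw [h2]
  have hx : ∀ b ∈ M, b ∈ closure (StarAlgebra.adjoin ℂ (Set.range f) : Set B) := by
    rw [hM]
    exact fun b hb => hb
  exact hx _ x.2

variable {S} in
theorem isUniversalCStarCover_of_evals {M : Type*} [CStarAlgebra M] (ι : S.Carrier →ₗ[ℂ] M)
    (hgen : (StarAlgebra.adjoin ℂ (Set.range ι)).topologicalClosure = ⊤)
    (ev : ∀ ρ : UcpMap S, M →⋆ₐ[ℂ] (ρ.K →L[ℂ] ρ.K)) (hev : ∀ ρ s, ev ρ (ι s) = ρ.φ s)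
    (hsep : ∀ a, (∀ ρ, ev ρ a = 0) → a = 0) : IsUniversalCStarCover S ι := by
  let idRep [Nontrivial H] : UcpMap S :=
    { K := H, φ := S.toSubmodule.subtype, cp := fun _ _ hx => hx, unital := rfl }
  refine ⟨⟨?_, ?_, ?_⟩, hgen, ?_⟩
  · rw [← sub_eq_zero]
    refine hsep _ fun ρ => ?_
    rw [map_sub, hev, map_one, ρ.unital, sub_self]
  · rcases subsingleton_or_nontrivial H with h | h
    · intro s t _
      exact Subtype.ext (Subsingleton.elim _ _)
    · intro s t hst
      have := congrArg (ev idRep) hst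
      rw [hev, hev] at this
      exact Subtype.ext this
  · intro n x
    constructor
    · intro hx
      refine isMatrixPositive_of_forall ev hsep _ fun ρ => ?_
      have := ρ.cp n x hx
      convert this using 1
      ext1 i j
      exact hev ρ _
    · intro hx
      rcases subsingleton_or_nontrivial H with h | h
      · exact ⟨0, by ext1 i j; exact Subsingleton.elim _ _⟩
      · have := hx.map (ev idRep)
        have e : (x.map ι).map (ev idRep) = x.map fun s => (s : H →L[ℂ] H) := by
          ext1 i j
          exact hev idRep _
        rw [e] at this
        exact this
  · intro K _ _ _ φ hφ h1
    rcases subsingleton_or_nontrivial K with h | h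
    · have hz (a b : K →L[ℂ] K) : a = b := Subsingleton.elim _ _
      exact ⟨{ toFun := fun _ => 0, map_one' := hz _ _, map_mul' := fun _ _ => hz _ _,
               map_zero' := hz _ _, map_add' := fun _ _ => hz _ _, commutes' := fun _ => hz _ _,
               map_star' := fun _ => hz _ _ }, fun s => hz _ _⟩
    · exact ⟨ev ⟨K, φ, hφ, h1⟩, hev ⟨K, φ, hφ, h1⟩⟩

variable {S} in
theorem IsUniversalCStarCover.transfer {M A : Type*} [CStarAlgebra M] [CStarAlgebra A]
    {ι : S.Carrier →ₗ[ℂ] M} (h : IsUniversalCStarCover S ι) (f : M →⋆ₐ[ℂ] A) (g : A →⋆ₐ[ℂ] M)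
    (hfg : ∀ a, f (g a) = a) (hgf : ∀ m, g (f m) = m) :
    IsUniversalCStarCover S (f.toAlgHom.toLinearMap ∘ₗ ι) := by
  refine ⟨⟨?_, ?_, ?_⟩, ?_, ?_⟩
  · change f (ι S.unit) = 1
    rw [h.embedding.map_unit, map_one]
  · exact (Function.LeftInverse.injective hgf).comp h.embedding.injective
  · intro n x
    rw [h.embedding.mem_cone_iff]
    refine ⟨fun hx => hx.map f, fun hx => ?_⟩
    convert hx.map g using 1
    ext1 i j
    exact (hgf _).symm
  · rw [eq_top_iff]
    intro a _
    have h1 : g a ∈ closure (StarAlgebra.adjoin ℂ (Set.range ι) : Set M) := by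
      have : g a ∈ (StarAlgebra.adjoin ℂ (Set.range ι)).topologicalClosure := by
        rw [h.generates]; trivial
      exact this
    have hf : Continuous f :=
      AddMonoidHomClass.continuous_of_bound f 1 fun m => by
        rw [one_mul]; exact NonUnitalStarAlgHom.norm_apply_le f m
    have h2 := image_closure_subset_closure_image hf ⟨_, h1, hfg a⟩
    have h3 : (StarAlgebra.adjoin ℂ (Set.range ι)).map f =
        StarAlgebra.adjoin ℂ (Set.range (f.toAlgHom.toLinearMap ∘ₗ ι)) := by
      rw [StarAlgHom.map_adjoin, ← Set.range_comp]
      rfl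
    change a ∈ closure _
    rw [← h3]
    exact h2
  · intro K _ _ _ φ hφ h1
    obtain ⟨π, hπ⟩ := h.extends_ucp K φ hφ h1
    refine ⟨π.comp g, fun s => ?_⟩
    change π (g (f (ι s))) = φ s
    rw [hgf, hπ]

theorem exists_isUniversalCStarCover :
    ∃ (A : Type u) (_ : CStarAlgebra A) (ι : S.Carrier →ₗ[ℂ] A), IsUniversalCStarCover S ι := by
  let M := (StarAlgebra.adjoin ℂ (Set.range (ucpProd S))).topologicalClosure
  have hclosed : IsClosed (M : Set (lp (fun ρ : UcpMap S => ρ.K →L[ℂ] ρ.K) ∞)) :=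
    StarSubalgebra.isClosed_topologicalClosure _
  let instM : CStarAlgebra M := StarSubalgebra.cstarAlgebra M
  have : Small.{u} M := small_closure_adjoin (ucpProd S)
  have hmem (s) : ucpProd S s ∈ M :=
    StarSubalgebra.le_topologicalClosure _ (StarAlgebra.subset_adjoin ℂ _ ⟨s, rfl⟩)
  let ι₀ : S.Carrier →ₗ[ℂ] M := (ucpProd S).codRestrict M.toSubalgebra.toSubmodule hmem
  have hι₀ : IsUniversalCStarCover S ι₀ :=
    isUniversalCStarCover_of_evals ι₀
      (adjoin_codRestrict_eq_top (ucpProd S) M rfl ι₀ fun _ => rfl)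
      (fun ρ => (lpEval _ ρ).comp M.subtype) (fun _ _ => rfl)
      (fun a ha => Subtype.ext (lp.ext (funext ha)))
  obtain ⟨A, instA, f, g, hfg, hgf⟩ := exists_shrink.{u} M
  exact ⟨A, instA, _, hι₀.transfer f g hfg hgf⟩

end Existence

end OpSys

namespace OpSys

/-! ### Matrix positivity -/

namespace IsMatrixPositive

/-! A matrix over the maximal tensor product is positive exactly when all its images under commuting
families of representations are positive, since the algebra sits inside the product of these
representations. Composing such a family with the `ι j` gives commuting completely positive maps, so
positivity in the commuting cone implies positivity in the induced cone.

Conversely, commuting unital completely positive maps extend to the covers, and the extensions still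
commute: completely positive maps preserve adjoints and the range of `ι j` generates
(`exists_commutingRep`). There remains the passage from unital maps to arbitrary ones
(`exists_normalization`). For states `f j` and `t ≠ 0`, the perturbation `φ j + t² f j` has an
invertible value `b j * b j` at the unit. Compressing by `(b j)⁻¹` gives commuting unital maps `ψ
j`, and the product of the perturbed maps is `B (ψ₁ ⋯ ψ_k) B` with `B = b₁ ⋯ b_k` selfadjoint.
Conjugation by `B` preserves positivity, and the positive cone is closed, so `t → 0` gives the claim
for `φ`.

For injectivity, products of vector states are commuting unital completely positive maps into
scalars, hence factor through the maximal tensor product. Vector states separate the points of each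
`S j`, so their products separate the points of the algebraic tensor product
(`eq_zero_of_forall_prodMap_eq_zero`). -/

theorem conj {A : Type*} [Ring A] [StarRing A] {n : ℕ} {a : Matrix (Fin n) (Fin n) A}
    (h : IsMatrixPositive a) (c : A) : IsMatrixPositive (a.map fun y => star c * y * c) := by
  obtain ⟨b, rfl⟩ := h
  refine ⟨b.map (· * c), ?_⟩
  ext i j
  simp [Matrix.mul_apply, Matrix.star_apply, Finset.mul_sum, Finset.sum_mul, mul_assoc]

theorem add {A : Type*} [CStarAlgebra A] {n : ℕ} {a b : Matrix (Fin n) (Fin n) A}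
    (ha : IsMatrixPositive a) (hb : IsMatrixPositive b) : IsMatrixPositive (a + b) := by
  let := CStarAlgebra.spectralOrder A
  have := CStarAlgebra.spectralOrderedRing A
  rw [isMatrixPositive_iff] at *
  exact add_nonneg ha hb

/-- The positive cone of the C*-algebra `M_n(A)` is norm closed, and the norm topology there is that
of entrywise convergence. -/
theorem of_tendsto {A : Type*} [CStarAlgebra A] {n : ℕ} {I : Type*} {l : Filter I} [l.NeBot]
    {a : I → Matrix (Fin n) (Fin n) A} {a₀ : Matrix (Fin n) (Fin n) A}
    (ha : ∀ᶠ t in l, IsMatrixPositive (a t))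
    (hlim : ∀ i j, Filter.Tendsto (fun t => a t i j) l (nhds (a₀ i j))) :
    IsMatrixPositive a₀ := by
  let := CStarAlgebra.spectralOrder A
  have := CStarAlgebra.spectralOrderedRing A
  simp only [isMatrixPositive_iff] at *
  refine ge_of_tendsto (f := fun t => CStarMatrix.ofMatrix (a t)) ?_ ha
  have h : Filter.Tendsto a l (nhds a₀) := tendsto_pi_nhds.2 fun i => tendsto_pi_nhds.2 (hlim i)
  exact ((CStarMatrix.ofMatrixL (A := A)).continuous.tendsto a₀).comp h

theorem of_subsingleton {A : Type*} [Ring A] [StarRing A] [Subsingleton A] {n : ℕ}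
    (a : Matrix (Fin n) (Fin n) A) : IsMatrixPositive a :=
  ⟨0, by ext1 i j; exact Subsingleton.elim _ _⟩

end IsMatrixPositive

/-! ### Product maps: homomorphisms, conjugation, continuity -/

section ProdMap

variable {k : ℕ} {V : Fin k → Type*} [∀ j, AddCommGroup (V j)] [∀ j, Module ℂ (V j)]

theorem map_prodMap {B C : Type*} [Ring B] [Algebra ℂ B] [Ring C] [Algebra ℂ C] (g : B →ₐ[ℂ] C)
    (φ : ∀ j, V j →ₗ[ℂ] B) (x : ⨂[ℂ] j, V j) :
    g (prodMap φ x) = prodMap (fun j => g.toLinearMap ∘ₗ φ j) x := by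
  have : g.toLinearMap ∘ₗ prodMap φ = prodMap fun j => g.toLinearMap ∘ₗ φ j := by
    ext v
    simp [prodMap_tprod, map_list_prod, List.map_ofFn, Function.comp_def]
  exact LinearMap.congr_fun this x

/-- Each `b i` can be moved past the other factors, so one copy collects on the left and one on the
right. The `y j` keep their order and need not commute with one another, nor `b j` with `y j`. -/
theorem prod_ofFn_conj {B : Type*} [Monoid B] : ∀ {k : ℕ} (b y : Fin k → B),
    (∀ i j, Commute (b i) (b j)) → (∀ i j, i ≠ j → Commute (b i) (y j)) →
    (List.ofFn fun j => b j * y j * b j).prod =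
      (List.ofFn b).prod * (List.ofFn y).prod * (List.ofFn b).prod
  | 0, _, _, _, _ => by simp
  | k + 1, b, y, hb, hby => by
    have ih := prod_ofFn_conj (fun j => b (Fin.succ j)) (fun j => y (Fin.succ j))
      (fun i j => hb _ _) fun i j hij => hby _ _ (by simpa using hij)
    simp only [List.ofFn_succ, List.prod_cons]
    rw [ih]
    have h1 : Commute (b 0) (List.ofFn fun j => b (Fin.succ j)).prod :=
      Commute.list_prod_right _ _ (by simpa [List.forall_mem_ofFn_iff] using fun j => hb 0 _)
    have h2 : Commute (y 0) (List.ofFn fun j => b (Fin.succ j)).prod :=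
      Commute.list_prod_right _ _ (by
        simpa [List.forall_mem_ofFn_iff] using fun j => (hby _ 0 (Fin.succ_ne_zero j)).symm)
    have h3 : Commute (b 0) (List.ofFn fun j => y (Fin.succ j)).prod :=
      Commute.list_prod_right _ _ (by
        simpa [List.forall_mem_ofFn_iff] using fun j => hby 0 _ (Fin.succ_ne_zero j).symm)
    generalize (List.ofFn fun j => b (Fin.succ j)).prod = P at *
    generalize (List.ofFn fun j => y (Fin.succ j)).prod = Y at *
    calc b 0 * y 0 * b 0 * (P * Y * P) = b 0 * y 0 * (b 0 * P) * Y * P := by simp only [mul_assoc]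
      _ = b 0 * (y 0 * P) * (b 0 * Y) * P := by rw [h1.eq]; simp only [mul_assoc]
      _ = b 0 * P * (y 0 * Y) * (b 0 * P) := by rw [h2.eq, h3.eq]; simp only [mul_assoc]

theorem isSelfAdjoint_prod_ofFn {B : Type*} [Monoid B] [StarMul B] : ∀ {k : ℕ} (b : Fin k → B),
    (∀ i, IsSelfAdjoint (b i)) → (∀ i j, Commute (b i) (b j)) →
    IsSelfAdjoint (List.ofFn b).prod
  | 0, _, _, _ => by simp [IsSelfAdjoint]
  | k + 1, b, hs, hb => by
    have ih := isSelfAdjoint_prod_ofFn (fun j => b (Fin.succ j)) (fun _ => hs _) fun _ _ => hb _ _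
    have h1 : Commute (b 0) (List.ofFn fun j => b (Fin.succ j)).prod :=
      Commute.list_prod_right _ _ (by simpa [List.forall_mem_ofFn_iff] using fun j => hb 0 _)
    rw [List.ofFn_succ, List.prod_cons, IsSelfAdjoint, star_mul, ih.star_eq, (hs 0).star_eq, h1.eq]

theorem prodMap_conj {B : Type*} [Ring B] [Algebra ℂ B] (b : Fin k → B)
    (φ ψ : ∀ j, V j →ₗ[ℂ] B) (hφ : ∀ j v, φ j v = b j * ψ j v * b j)
    (hb : ∀ i j, Commute (b i) (b j)) (hbψ : ∀ i j, i ≠ j → ∀ v, Commute (b i) (ψ j v))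
    (x : ⨂[ℂ] j, V j) :
    prodMap φ x = (List.ofFn b).prod * prodMap ψ x * (List.ofFn b).prod := by
  have : prodMap φ = LinearMap.mulLeftRight ℂ ((List.ofFn b).prod, (List.ofFn b).prod) ∘ₗ
      prodMap ψ := by
    ext v
    simp only [LinearMap.compMultilinearMap_apply, LinearMap.comp_apply, prodMap_tprod, hφ,
      LinearMap.mulLeftRight_apply]
    exact prod_ofFn_conj b _ hb fun i j hij => hbψ i j hij _
  rw [this, LinearMap.comp_apply, LinearMap.mulLeftRight_apply]

theorem continuous_prodMap {B : Type*} [NormedRing B] [NormedAlgebra ℂ B] {T : Type*}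
    [TopologicalSpace T] (φ : T → ∀ j, V j →ₗ[ℂ] B) (hφ : ∀ j v, Continuous fun t => φ t j v)
    (x : ⨂[ℂ] j, V j) : Continuous fun t => prodMap (φ t) x := by
  induction x using PiTensorProduct.induction_on with
  | smul_tprod r v =>
    simp only [map_smul, prodMap_tprod, List.ofFn_eq_map]
    exact (continuous_list_prod _ fun j _ => hφ j _).const_smul r
  | add x y hx hy => simpa only [map_add] using! hx.add hy

/-! ### Product functionals separate the points of a tensor product -/

theorem prodMap_eq_dualDistrib (f : ∀ j, V j →ₗ[ℂ] ℂ) (x : ⨂[ℂ] j, V j) :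
    prodMap f x = PiTensorProduct.dualDistrib (PiTensorProduct.tprod ℂ f) x := by
  have : prodMap f = PiTensorProduct.dualDistrib (PiTensorProduct.tprod ℂ f) := by
    ext v
    simp [prodMap_tprod, List.prod_ofFn]
  rw [this]

theorem prodMap_eq_zero_of_mem_span (F : ∀ j, Set (V j →ₗ[ℂ] ℂ)) (x : ⨂[ℂ] j, V j)
    (hx : ∀ f : ∀ j, V j →ₗ[ℂ] ℂ, (∀ j, f j ∈ F j) → prodMap f x = 0)
    (g : ∀ j, V j →ₗ[ℂ] ℂ) (hg : ∀ j, g j ∈ Submodule.span ℂ (F j)) : prodMap g x = 0 := by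
  let m : MultilinearMap ℂ (fun j => V j →ₗ[ℂ] ℂ) ℂ :=
    (LinearMap.applyₗ x ∘ₗ PiTensorProduct.dualDistrib).compMultilinearMap (PiTensorProduct.tprod ℂ)
  have hm (f) : m f = prodMap f x := (prodMap_eq_dualDistrib f x).symm
  -- The value at `x` is multilinear in the functionals, so the slots can be relaxed from `F j` to
  -- its span one at a time; `s` is the set of slots already relaxed.
  suffices ∀ s : Finset (Fin k), ∀ g : ∀ j, V j →ₗ[ℂ] ℂ,
      (∀ j ∈ s, g j ∈ Submodule.span ℂ (F j)) → (∀ j ∉ s, g j ∈ F j) → m g = 0 by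
    rw [← hm]
    exact this Finset.univ g (fun j _ => hg j) (by simp)
  intro s
  induction s using Finset.induction_on with
  | empty => exact fun g _ h => (hm g).trans (hx g fun j => h j (by simp))
  | insert i s hi ih =>
    intro g h1 h2
    suffices ∀ f ∈ Submodule.span ℂ (F i), m (Function.update g i f) = 0 by
      simpa using this (g i) (h1 i (by simp))
    intro f hf
    induction hf using Submodule.span_induction with
    | mem f hf =>
      refine ih _ (fun j hj => ?_) fun j hj => ?_
      · rw [Function.update_of_ne (by rintro rfl; exact hi hj)]
        exact h1 j (by simp [hj])
      · rcases eq_or_ne j i with rfl | hji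
        · simpa using hf
        · rw [Function.update_of_ne hji]
          exact h2 j (by simp [hji, hj])
    | zero => exact m.map_update_zero _ _
    | add f f' _ _ hf hf' => rw [m.map_update_add, hf, hf', add_zero]
    | smul c f _ hf => rw [m.map_update_smul, hf, smul_zero]

/-- If the evaluations of the span at the `v i` did not fill `I → ℂ`, a nonzero functional `d` would
vanish on them. Then every member of `F` kills `∑ d_i v_i`, where `d_i` is the value of `d` at the
`i`-th unit vector; this vector is thus zero, against linear independence. -/
theorem exists_mem_span_apply_eq {W I : Type*} [AddCommGroup W] [Module ℂ W]
    (F : Set (W →ₗ[ℂ] ℂ)) (hF : ∀ w, (∀ f ∈ F, f w = 0) → w = 0) [Finite I] (v : I → W)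
    (hv : LinearIndependent ℂ v) (c : I → ℂ) :
    ∃ g ∈ Submodule.span ℂ F, ∀ i, g (v i) = c i := by
  classical
  have := Fintype.ofFinite I
  let T : (W →ₗ[ℂ] ℂ) →ₗ[ℂ] (I → ℂ) := LinearMap.pi fun i => LinearMap.applyₗ (v i)
  suffices (Submodule.span ℂ F).map T = ⊤ by
    obtain ⟨g, hg, h⟩ : c ∈ (Submodule.span ℂ F).map T := this ▸ Submodule.mem_top
    exact ⟨g, hg, fun i => congrFun h i⟩
  by_contra hne
  obtain ⟨d, hd, hd'⟩ := Submodule.exists_dual_map_eq_bot_of_lt_top (lt_top_iff_ne_top.2 hne)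
    inferInstance
  have hd1 (y : I → ℂ) : d y = ∑ i, y i * d (Pi.single i 1) := by
    conv_lhs => rw [pi_eq_sum_univ' y, map_sum]
    simp
  have h0 : ∑ i, d (Pi.single i 1) • v i = 0 := hF _ fun f hf => by
    have : d (T f) ∈ ((Submodule.span ℂ F).map T).map d :=
      Submodule.mem_map_of_mem (Submodule.mem_map_of_mem (Submodule.subset_span hf))
    rw [hd', Submodule.mem_bot, hd1] at this
    simpa [T, mul_comm] using this
  refine hd (LinearMap.ext fun y => ?_)
  rw [hd1]
  simp [Fintype.linearIndependent_iff.1 hv _ h0]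

/-- Only finitely many basis vectors occur in `x`, and on these the span of `F j` contains a
functional acting as a dual coordinate. Products of such functionals read off each coordinate of
`x`. -/
theorem eq_zero_of_forall_prodMap_eq_zero (F : ∀ j, Set (V j →ₗ[ℂ] ℂ))
    (hF : ∀ j v, (∀ f ∈ F j, f v = 0) → v = 0) (x : ⨂[ℂ] j, V j)
    (hx : ∀ f : ∀ j, V j →ₗ[ℂ] ℂ, (∀ j, f j ∈ F j) → prodMap f x = 0) : x = 0 := by
  classical
  let b (j) := Module.Basis.ofVectorSpace ℂ (V j)
  let e := Basis.piTensorProduct b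
  rw [← e.repr.map_eq_zero_iff]
  ext p
  -- All indices occurring in `x` in slot `j`; `p j` is inserted so that `g j` is also prescribed
  -- there when `p` is outside the support.
  let s (j) : Finset _ := insert (p j) ((e.repr x).support.image fun q => q j)
  have hg (j) := exists_mem_span_apply_eq (F j) (hF j) (fun i : s j => b j i)
    ((b j).linearIndependent.comp _ Subtype.val_injective) fun i => if (i : _) = p j then 1 else 0
  choose g hgF hgb using hg
  have h0 := prodMap_eq_zero_of_mem_span F x hx g hgF
  rw [← e.linearCombination_repr x, Finsupp.linearCombination_apply, Finsupp.sum, map_sum] at h0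
  rw [Finset.sum_eq_single p] at h0
  · rw [map_smul, Basis.piTensorProduct_apply, prodMap_tprod, List.prod_ofFn,
      Finset.prod_eq_one, smul_eq_mul, mul_one] at h0
    · exact h0
    · intro j _
      simpa using hgb j ⟨p j, by simp [s]⟩
  · intro q hq hqp
    obtain ⟨j, hj⟩ := Function.ne_iff.1 hqp
    rw [map_smul, Basis.piTensorProduct_apply, prodMap_tprod, List.prod_ofFn,
      Finset.prod_eq_zero (Finset.mem_univ j), smul_zero]
    simpa [hj] using hgb j ⟨q j, Finset.mem_insert_of_mem (Finset.mem_image_of_mem _ hq)⟩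
  · intro hp
    rw [Finsupp.notMem_support_iff.1 hp, zero_smul, map_zero]

end ProdMap

/-! ### Completely positive maps -/

section CompletelyPositive

variable {H : Type*} [NormedAddCommGroup H] [InnerProductSpace ℂ H] [CompleteSpace H]

/-- The vector functional `s ↦ ⟪h, s h⟫` on an operator system. -/
noncomputable def OperatorSystem.vectorFunctional (S : OperatorSystem H) (h : H) :
    S.Carrier →ₗ[ℂ] ℂ where
  toFun s := inner ℂ h ((s : H →L[ℂ] H) h)
  map_add' s t := by simp
  map_smul' c s := by simp

open scoped MatrixOrder in
-- If `x = b* b`, then `⟪h, x i j h⟫ = ∑ l, ⟪b l i h, b l j h⟫`, so the image of `x` is a Gram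
-- matrix.
theorem OperatorSystem.isMatrixPositive_map_vectorFunctional (S : OperatorSystem H) (h : H) {n : ℕ}
    {x : Matrix (Fin n) (Fin n) S.Carrier} (hx : x ∈ S.cone n) :
    IsMatrixPositive (x.map (S.vectorFunctional h)) := by
  obtain ⟨b, hb⟩ := hx
  let v : Fin n → PiLp 2 fun _ : Fin n => H := fun i => WithLp.toLp 2 fun l => b l i h
  have hv : x.map (S.vectorFunctional h) = Matrix.gram ℂ v := by
    ext i j
    have hij : (x i j : H →L[ℂ] H) = ∑ l, star (b l i) * b l j := by
      have := congrFun (congrFun hb i) j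
      simpa [Matrix.mul_apply, Matrix.star_apply] using this
    change inner ℂ h ((x i j : H →L[ℂ] H) h) = inner ℂ (v i) (v j)
    rw [hij, PiLp.inner_apply, sum_apply, inner_sum]
    refine Finset.sum_congr rfl fun l _ => ?_
    rw [ContinuousLinearMap.star_eq_adjoint, mul_apply_eq_comp,
      ContinuousLinearMap.adjoint_inner_right]
  rw [hv]
  exact CStarAlgebra.nonneg_iff_eq_star_mul_self.1 (Matrix.posSemidef_gram ℂ v).nonneg

theorem OperatorSystem.vectorFunctional_unit (S : OperatorSystem H) {h : H} (hh : ‖h‖ = 1) :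
    S.vectorFunctional h S.unit = 1 := by
  change inner ℂ h h = 1
  simp [inner_self_eq_norm_sq_to_K, hh]

/-- Over `ℂ`, polarization shows that an operator is determined by its quadratic form; scaling
reduces this to unit vectors. -/
theorem OperatorSystem.eq_zero_of_vectorFunctional (S : OperatorSystem H) (s : S.Carrier)
    (hs : ∀ f ∈ {f | ∃ h : H, ‖h‖ = 1 ∧ S.vectorFunctional h = f}, f s = 0) : s = 0 := by
  refine Subtype.ext (ContinuousLinearMap.coe_injective ?_)
  refine (inner_map_self_eq_zero (s : H →L[ℂ] H).toLinearMap).1 fun h => ?_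
  rcases eq_or_ne h 0 with rfl | hh
  · simp
  have h1 := hs _ ⟨((‖h‖⁻¹ : ℝ) : ℂ) • h, by simp [norm_smul, hh], rfl⟩
  have h2 : inner ℂ h ((s : H →L[ℂ] H) h) = 0 := by
    simpa [OperatorSystem.vectorFunctional, inner_smul_left, inner_smul_right, hh] using h1
  rw [← inner_conj_symm]
  simp [h2]

variable {A : Type*} [CStarAlgebra A]

namespace OperatorSystem.IsCompletelyPositive

variable {S : OperatorSystem H}

theorem of_functional {f : S.Carrier →ₗ[ℂ] ℂ}
    (hf : ∀ n, ∀ x ∈ S.cone n, IsMatrixPositive (x.map f)) :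
    S.IsCompletelyPositive (Algebra.linearMap ℂ A ∘ₗ f) := fun n x hx =>
  (hf n x hx).map (StarAlgHom.ofId ℂ A)

theorem add {φ ψ : S.Carrier →ₗ[ℂ] A} (hφ : S.IsCompletelyPositive φ)
    (hψ : S.IsCompletelyPositive ψ) : S.IsCompletelyPositive (φ + ψ) := fun n x hx =>
  (hφ n x hx).add (hψ n x hx)

theorem conj {φ : S.Carrier →ₗ[ℂ] A} (hφ : S.IsCompletelyPositive φ) {c : A}
    (hc : IsSelfAdjoint c) : S.IsCompletelyPositive (LinearMap.mulLeftRight ℂ (c, c) ∘ₗ φ) :=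
  fun n x hx => by
    have := (hφ n x hx).conj c
    rw [hc.star_eq] at this
    exact this

/-- The scalar is written `t * t` because the scaling is conjugation by the selfadjoint element `t •
1`. -/
theorem real_smul {φ : S.Carrier →ₗ[ℂ] A} (hφ : S.IsCompletelyPositive φ) (t : ℝ) :
    S.IsCompletelyPositive (((t * t : ℝ) : ℂ) • φ) := by
  have hc : IsSelfAdjoint ((t : ℂ) • (1 : A)) := by
    simp [IsSelfAdjoint]
  have h := hφ.conj hc
  convert h using 1
  ext s
  simp [smul_smul, -Complex.ofReal_mul]

theorem comp {B : Type*} [CStarAlgebra B] {φ : S.Carrier →ₗ[ℂ] A}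
    (hφ : S.IsCompletelyPositive φ) (π : A →⋆ₐ[ℂ] B) :
    S.IsCompletelyPositive (π.toAlgHom.toLinearMap ∘ₗ φ) := fun n x hx => (hφ n x hx).map π

end OperatorSystem.IsCompletelyPositive

end CompletelyPositive

/-! ### Completely positive maps preserve adjoints -/

section Star

variable {H : Type u} [NormedAddCommGroup H] [InnerProductSpace ℂ H] [CompleteSpace H]
  {S : OperatorSystem H} {K : Type*} [NormedAddCommGroup K] [InnerProductSpace ℂ K]
  [CompleteSpace K] {φ : S.Carrier →ₗ[ℂ] (K →L[ℂ] K)}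

theorem OperatorSystem.IsCompletelyPositive.map_unit_nonneg (hφ : S.IsCompletelyPositive φ) :
    0 ≤ φ S.unit :=
  hφ.map_nonneg _ (zero_le_one' (H →L[ℂ] H))

/-- `a` is the difference of the positive elements `‖a‖ • 1 + a` and `‖a‖ • 1`. -/
theorem OperatorSystem.IsCompletelyPositive.isSelfAdjoint_map (hφ : S.IsCompletelyPositive φ)
    (a : S.Carrier) (ha : IsSelfAdjoint (a : H →L[ℂ] H)) : IsSelfAdjoint (φ a) := by
  set r : ℝ := ‖(a : H →L[ℂ] H)‖
  have hp : 0 ≤ φ ((r : ℂ) • S.unit + a) := hφ.map_nonneg _ (by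
    have := ha.neg_algebraMap_norm_le_self
    rw [Algebra.algebraMap_eq_smul_one, ← Complex.coe_smul, neg_le_iff_add_nonneg'] at this
    exact this)
  have hr : IsSelfAdjoint ((r : ℂ) • φ S.unit) :=
    IsSelfAdjoint.smul (by simp [IsSelfAdjoint]) (IsSelfAdjoint.of_nonneg hφ.map_unit_nonneg)
  have := (IsSelfAdjoint.of_nonneg hp).sub hr
  rwa [map_add, map_smul, add_sub_cancel_left] at this

theorem OperatorSystem.IsCompletelyPositive.map_star (hφ : S.IsCompletelyPositive φ)
    (s : S.Carrier) : star (φ s) = φ ⟨star s, S.star_mem' s.2⟩ := by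
  let t : S.Carrier := ⟨star s, S.star_mem' s.2⟩
  -- Up to scalars, `s + s*` and `i (s - s*)` are the real and imaginary parts of `s`.
  have ha := hφ.isSelfAdjoint_map (s + t) (by simp [t, IsSelfAdjoint, add_comm])
  have hb := hφ.isSelfAdjoint_map (Complex.I • (s - t)) (by simp [t, IsSelfAdjoint, ← smul_neg])
  have h1 : star (φ s) + star (φ t) = φ s + φ t := by simpa [IsSelfAdjoint] using ha
  have h2 : star (φ s) - star (φ t) = φ t - φ s := by
    have h3 := hb.star_eq
    rw [map_smul, star_smul, Complex.star_def, Complex.conj_I, neg_smul, ← smul_neg] at h3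
    have h4 := smul_right_injective (K →L[ℂ] K) Complex.I_ne_zero h3
    rw [map_sub, star_sub, neg_sub] at h4
    rw [← neg_sub, h4, neg_sub]
  change star (φ s) = φ t
  have h5 : (2 : ℂ) • star (φ s) = (2 : ℂ) • φ t := by
    rw [two_smul, two_smul]
    calc star (φ s) + star (φ s)
        = (star (φ s) + star (φ t)) + (star (φ s) - star (φ t)) := by abel
      _ = φ t + φ t := by rw [h1, h2]; abel
  exact smul_right_injective (K →L[ℂ] K) two_ne_zero h5

end Star

/-! ### Normalization of commuting completely positive maps -/

/-- `b` is the square root of the strictly positive element `a + r` and `c` its inverse. By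
functional calculus, whatever commutes with `a` commutes with both. -/
theorem exists_sqrt_add_smul_one {A : Type*} [CStarAlgebra A] [PartialOrder A] [StarOrderedRing A]
    {a : A} (ha : 0 ≤ a) {r : ℝ} (hr : 0 < r) :
    ∃ b c : A, IsSelfAdjoint b ∧ IsSelfAdjoint c ∧ b * c = 1 ∧ c * b = 1 ∧
      b * b = a + (r : ℂ) • 1 ∧ ∀ T, Commute T a → Commute T b ∧ Commute T c := by
  have hr1 : IsStrictlyPositive ((r : ℂ) • (1 : A)) := by
    rw [Complex.coe_smul]
    exact IsStrictlyPositive.smul hr isStrictlyPositive_one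
  have hp : IsStrictlyPositive (a + (r : ℂ) • (1 : A)) := hr1.nonneg_add ha
  obtain ⟨u, hu⟩ := hp.isUnit_cfcSqrt
  have hb : IsSelfAdjoint (u : A) := hu ▸ (CFC.sqrt_nonneg _).isSelfAdjoint
  have hc : IsSelfAdjoint ((u⁻¹ : Aˣ) : A) := by
    have : star u = u := Units.ext hb.star_eq
    rw [IsSelfAdjoint, ← Units.coe_star, star_inv, this]
  refine ⟨u, (u⁻¹ : Aˣ), hb, hc, u.mul_inv, u.inv_mul, ?_, fun T hT => ?_⟩
  · rw [hu, CFC.sqrt_mul_sqrt_self _ hp.nonneg]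
  · have hT' : Commute T (a + (r : ℂ) • (1 : A)) := hT.add_right ((Commute.one_right T).smul_right _)
    have h : Commute T (u : A) := by
      rw [hu, CFC.sqrt]
      exact (hT'.symm.cfcₙ_nnreal _).symm
    exact ⟨h, h.units_inv_right⟩

section Normalize

variable {k : ℕ} {H : Fin k → Type u} [∀ j, NormedAddCommGroup (H j)]
  [∀ j, InnerProductSpace ℂ (H j)] [∀ j, CompleteSpace (H j)] {S : ∀ j, OperatorSystem (H j)}
  {K : Type*} [NormedAddCommGroup K] [InnerProductSpace ℂ K] [CompleteSpace K]

theorem exists_normalization (φ : ∀ j, (S j).Carrier →ₗ[ℂ] (K →L[ℂ] K))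
    (hφ : ∀ j, (S j).IsCompletelyPositive (φ j)) (hcomm : CommutingRanges fun j => φ j)
    (f : ∀ j, (S j).Carrier →ₗ[ℂ] ℂ)
    (hf : ∀ j n, ∀ x ∈ (S j).cone n, IsMatrixPositive (x.map (f j)))
    (hf1 : ∀ j, f j (S j).unit = 1) {t : ℝ} (ht : t ≠ 0) :
    ∃ ψ : ∀ j, (S j).Carrier →ₗ[ℂ] (K →L[ℂ] K), (∀ j, (S j).IsCompletelyPositive (ψ j)) ∧
      (∀ j, ψ j (S j).unit = 1) ∧ (CommutingRanges fun j => ψ j) ∧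
      ∃ B : K →L[ℂ] K, IsSelfAdjoint B ∧ ∀ x,
        prodMap (fun j => φ j + ((t * t : ℝ) : ℂ) • (Algebra.linearMap ℂ (K →L[ℂ] K) ∘ₗ f j)) x =
          B * prodMap ψ x * B := by
  have h (j) := exists_sqrt_add_smul_one (hφ j).map_unit_nonneg (mul_self_pos.2 ht)
  choose b c hb hc hbc hcb hbb hT using h
  let φ' (j) := φ j + ((t * t : ℝ) : ℂ) • (Algebra.linearMap ℂ (K →L[ℂ] K) ∘ₗ f j)
  have hφ'1 (j) : φ' j (S j).unit = b j * b j := by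
    simp [φ', hf1, hbb]
  -- Here `c j` is the inverse of `b j`, so `ψ j` sends the unit to `c j * (b j * b j) * c j = 1`.
  let ψ (j) := LinearMap.mulLeftRight ℂ (c j, c j) ∘ₗ φ' j
  have hψ (j s) : ψ j s = c j * φ' j s * c j := rfl
  have hφφ' (i j) (hij : i ≠ j) (s s') : Commute (φ i s) (φ' j s') := by
    change Commute (φ i s) (φ j s' + ((t * t : ℝ) : ℂ) • algebraMap ℂ (K →L[ℂ] K) (f j s'))
    exact Commute.add_right (hcomm i j hij s s')
      ((Algebra.commute_algebraMap_right (f j s') (φ i s)).smul_right _)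
  have hφ'φ' (i j) (hij : i ≠ j) (s s') : Commute (φ' i s) (φ' j s') := by
    change Commute (φ i s + ((t * t : ℝ) : ℂ) • algebraMap ℂ (K →L[ℂ] K) (f i s)) (φ' j s')
    exact (hφφ' i j hij s s').add_left ((Algebra.commute_algebraMap_left (f i s) (φ' j s')).smul_left _)
  have hφ'b (i j) (hij : i ≠ j) (s) : Commute (φ' i s) (b j) ∧ Commute (φ' i s) (c j) :=
    hT j _ (hφφ' j i hij.symm _ _).symm
  have hbφ (i j) (hij : i ≠ j) : Commute (b i) (φ j (S j).unit) :=
    (hT i _ (hcomm j i hij.symm _ _)).1.symm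
  have hcφ (i j) (hij : i ≠ j) : Commute (c i) (φ j (S j).unit) :=
    (hT i _ (hcomm j i hij.symm _ _)).2.symm
  have hbψ (i j) (hij : i ≠ j) (s) : Commute (b i) (ψ j s) :=
    (((hT j _ (hbφ i j hij)).2.mul_right (hφ'b j i hij.symm s).1.symm).mul_right
      (hT j _ (hbφ i j hij)).2)
  have hcψ (i j) (hij : i ≠ j) (s) : Commute (c i) (ψ j s) :=
    (((hT j _ (hcφ i j hij)).2.mul_right (hφ'b j i hij.symm s).2.symm).mul_right
      (hT j _ (hcφ i j hij)).2)
  have hφ'ψ (i j) (hij : i ≠ j) (s s') : Commute (φ' i s) (ψ j s') :=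
    ((hφ'b i j hij s).2.mul_right (hφ'φ' i j hij s s')).mul_right (hφ'b i j hij s).2
  have hbb' (i j) : Commute (b i) (b j) := by
    rcases eq_or_ne i j with rfl | hij
    · exact Commute.refl _
    · exact (hT j _ (hbφ i j hij)).1
  refine ⟨ψ, fun j => ?_, fun j => ?_, fun i j hij s s' => ?_, (List.ofFn b).prod,
    isSelfAdjoint_prod_ofFn b hb hbb', fun x => prodMap_conj b φ' ψ (fun j s => ?_) hbb' hbψ x⟩
  · exact ((hφ j).add ((OperatorSystem.IsCompletelyPositive.of_functional (hf j)).real_smul t)).conj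
      (hc j)
  · rw [hψ, hφ'1, ← mul_assoc, hcb, one_mul, hbc]
  · exact ((hcψ i j hij s').mul_left (hφ'ψ i j hij s s')).mul_left (hcψ i j hij s')
  · rw [hψ]
    calc φ' j s = (b j * c j) * φ' j s * (c j * b j) := by rw [hbc, hcb, one_mul, mul_one]
      _ = _ := by simp only [mul_assoc]

/-- If `(ψ₁ ⋯ ψ_k)⁽ⁿ⁾(x)` is positive for all commuting unital completely positive maps into `B(K)`,
it is positive for all commuting completely positive maps into `B(K)`. -/
theorem isMatrixPositive_map_prodMap_of_unital {n : ℕ}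
    (x : Matrix (Fin n) (Fin n) (⨂[ℂ] j, (S j).Carrier))
    (hx : ∀ ψ : ∀ j, (S j).Carrier →ₗ[ℂ] (K →L[ℂ] K), (∀ j, (S j).IsCompletelyPositive (ψ j)) →
      (∀ j, ψ j (S j).unit = 1) → (CommutingRanges fun j => ψ j) →
      IsMatrixPositive (x.map (prodMap ψ)))
    (φ : ∀ j, (S j).Carrier →ₗ[ℂ] (K →L[ℂ] K)) (hφ : ∀ j, (S j).IsCompletelyPositive (φ j))
    (hcomm : CommutingRanges fun j => φ j) : IsMatrixPositive (x.map (prodMap φ)) := by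
  by_cases hH : ∀ j, Nontrivial (H j)
  -- Nonzero spaces provide unit vectors, whose vector states serve as the perturbing functionals.
  · choose h hh using fun j => exists_norm_eq (H j) zero_le_one
    let f (j) := (S j).vectorFunctional (h j)
    let φ' (t : ℝ) (j) := φ j + ((t * t : ℝ) : ℂ) • (Algebra.linearMap ℂ (K →L[ℂ] K) ∘ₗ f j)
    refine IsMatrixPositive.of_tendsto (l := nhdsWithin (0 : ℝ) {0}ᶜ)
      (a := fun t => x.map (prodMap (φ' t))) ?_ fun i j => ?_
    · filter_upwards [self_mem_nhdsWithin] with t ht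
      obtain ⟨ψ, hψ, hψ1, hψc, B, hB, hBψ⟩ := exists_normalization φ hφ hcomm f
        (fun j _ _ hx => (S j).isMatrixPositive_map_vectorFunctional (h j) hx)
        (fun j => (S j).vectorFunctional_unit (hh j)) ht
      have h1 : x.map (prodMap (φ' t)) = (x.map (prodMap ψ)).map fun y => star B * y * B := by
        rw [hB.star_eq]
        ext1 i j
        exact hBψ (x i j)
      exact h1 ▸ (hx ψ hψ hψ1 hψc).conj B
    · have hc : Continuous fun t : ℝ => prodMap (φ' t) (x i j) :=
        continuous_prodMap φ' (fun j s => by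
          simp only [φ', LinearMap.add_apply, LinearMap.smul_apply]
          fun_prop) _
      have h0 : φ' 0 = φ := by
        funext j
        simp [φ']
      have := hc.tendsto 0
      rw [h0] at this
      exact this.mono_left nhdsWithin_le_nhds
  · push Not at hH
    -- If some `H j` is zero, so is `S j`, and the product map vanishes on every pure tensor.
    obtain ⟨j, hj⟩ := hH
    have h0 : prodMap φ = 0 := by
      ext1
      ext1 v
      have hv : v j = 0 := Subtype.ext (Subsingleton.elim _ _)
      exact ((prodMap φ).compMultilinearMap (PiTensorProduct.tprod ℂ)).map_coord_zero j hv
    refine ⟨0, ?_⟩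
    ext1 p q
    simp [h0]

end Normalize

/-! ### The universal cover and the maximal tensor product -/

/-- The elements whose image commutes with both `T` and `star T` form a closed star subalgebra
containing the generators. The condition on `star T` is what makes this set closed under adjoints.
-/
theorem commute_map_of_generates {V A B : Type*} [CStarAlgebra A] [CStarAlgebra B] {ι : V → A}
    (hι : (StarAlgebra.adjoin ℂ (Set.range ι)).topologicalClosure = ⊤) (π : A →⋆ₐ[ℂ] B) {T : B}
    (h : ∀ v, Commute T (π (ι v))) (h' : ∀ v, Commute (star T) (π (ι v))) (a : A) :
    Commute T (π a) := by
  let Z : StarSubalgebra ℂ A := (StarSubalgebra.centralizer ℂ {T}).comap π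
  have hπ : Continuous π := AddMonoidHomClass.continuous_of_bound π 1 fun m => by
    rw [one_mul]; exact NonUnitalStarAlgHom.norm_apply_le π m
  have hZ : IsClosed (Z : Set A) := (Set.isClosed_centralizer _).preimage hπ
  have hle : (StarAlgebra.adjoin ℂ (Set.range ι)).topologicalClosure ≤ Z := by
    refine StarSubalgebra.topologicalClosure_minimal (StarAlgebra.adjoin_le ?_) hZ
    rintro _ ⟨v, rfl⟩
    exact (StarSubalgebra.mem_centralizer_iff ℂ).2 fun g hg => by
      rw [Set.mem_singleton_iff.1 hg]
      exact ⟨h v, h' v⟩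
  have ha : a ∈ Z := hle (hι ▸ StarSubalgebra.mem_top)
  exact ((StarSubalgebra.mem_centralizer_iff ℂ).1 ha T rfl).1

section Cover

variable {k : ℕ} {H : Fin k → Type u} [∀ j, NormedAddCommGroup (H j)]
  [∀ j, InnerProductSpace ℂ (H j)] [∀ j, CompleteSpace (H j)] {S : ∀ j, OperatorSystem (H j)}
  {A : Fin k → Type u} [∀ j, CStarAlgebra (A j)] {ι : ∀ j, (S j).Carrier →ₗ[ℂ] A j}

/-- The representation of the maximal tensor product given by commuting representations. -/
noncomputable def CommutingRep.eval (ρ : CommutingRep A) : maxTensor A →⋆ₐ[ℂ] (ρ.K →L[ℂ] ρ.K) :=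
  (lpEval (fun ρ : CommutingRep A => ρ.K →L[ℂ] ρ.K) ρ).comp (maxTensor A).subtype

theorem CommutingRep.eval_toMaxTensor (ρ : CommutingRep A) (x : ⨂[ℂ] j, (S j).Carrier) :
    ρ.eval (toMaxTensor ι x) = prodMap (fun j => (ρ.π j).toAlgHom.toLinearMap ∘ₗ ι j) x :=
  map_prodMap ρ.eval.toAlgHom _ x

theorem CommutingRep.eq_zero_of_eval {a : maxTensor A}
    (ha : ∀ ρ : CommutingRep A, ρ.eval a = 0) : a = 0 :=
  Subtype.ext (lp.ext (funext ha))

theorem isMatrixPositive_of_eval {n : ℕ} (a : Matrix (Fin n) (Fin n) (maxTensor A))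
    (ha : ∀ ρ : CommutingRep A, IsMatrixPositive (a.map ρ.eval)) : IsMatrixPositive a :=
  isMatrixPositive_of_forall (B := fun ρ : CommutingRep A => ρ.K →L[ℂ] ρ.K) CommutingRep.eval
    (fun _ h => CommutingRep.eq_zero_of_eval h) a ha

/-- Commuting unital completely positive maps on operator systems extend to commuting
representations of the universal C*-covers. -/
theorem exists_commutingRep (hι : ∀ j, IsUniversalCStarCover (S j) (ι j)) {K : Type u}
    [NormedAddCommGroup K] [InnerProductSpace ℂ K] [CompleteSpace K] [Nontrivial K]
    (φ : ∀ j, (S j).Carrier →ₗ[ℂ] (K →L[ℂ] K)) (hφ : ∀ j, (S j).IsCompletelyPositive (φ j))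
    (hφ1 : ∀ j, φ j (S j).unit = 1) (hcomm : CommutingRanges fun j => φ j) :
    ∃ e : maxTensor A →⋆ₐ[ℂ] (K →L[ℂ] K), ∀ x, e (toMaxTensor ι x) = prodMap φ x := by
  choose π hπ using fun j => (hι j).extends_ucp K (φ j) (hφ j) (hφ1 j)
  -- Commutation is extended one factor at a time, from the range of `φ j` to that of `π j` and then
  -- likewise for `i`. The adjoint of `φ i s` lies again in the range of `φ i`.
  have h1 (i j) (hij : i ≠ j) (s : (S i).Carrier) (a : A j) : Commute (φ i s) (π j a) := by
    refine commute_map_of_generates (hι j).generates (π j) (fun v => ?_) (fun v => ?_) a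
    · rw [hπ]
      exact hcomm i j hij s v
    · rw [hπ, (hφ i).map_star]
      exact hcomm i j hij _ v
  have h2 : CommutingRanges fun j => π j := fun i j hij a b => by
    refine (commute_map_of_generates (hι i).generates (π i) (T := π j b) (fun v => ?_)
      (fun v => ?_) a).symm
    · rw [hπ]
      exact (h1 i j hij v b).symm
    · rw [hπ, ← map_star]
      exact (h1 i j hij v _).symm
  let ρ : CommutingRep A := ⟨K, π, h2⟩
  refine ⟨ρ.eval, fun x => (ρ.eval_toMaxTensor x).trans ?_⟩
  congr 2
  funext j
  ext1 s
  exact hπ j s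

theorem toMaxTensor_injective (hι : ∀ j, IsUniversalCStarCover (S j) (ι j)) :
    Function.Injective (toMaxTensor ι) := by
  rw [injective_iff_map_eq_zero]
  intro x hx
  refine eq_zero_of_forall_prodMap_eq_zero
    (fun j => {f | ∃ h : H j, ‖h‖ = 1 ∧ (S j).vectorFunctional h = f})
    (fun j => (S j).eq_zero_of_vectorFunctional) x fun f hf => ?_
  choose h hh hf using hf
  -- A one-dimensional Hilbert space in the required universe; scalar operators on it commute and
  -- faithfully represent `ℂ`.
  let K := EuclideanSpace ℂ PUnit.{u + 1}
  obtain ⟨e, he⟩ := exists_commutingRep hι (K := K)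
    (fun j => Algebra.linearMap ℂ (K →L[ℂ] K) ∘ₗ (S j).vectorFunctional (h j))
    (fun j => .of_functional fun _ _ hx => (S j).isMatrixPositive_map_vectorFunctional (h j) hx)
    (fun j => by simp [(S j).vectorFunctional_unit (hh j)])
    (fun i j _ s s' => Algebra.commute_algebraMap_left ((S i).vectorFunctional (h i) s) _)
  have h0 := e.map_zero'.symm.trans (hx ▸ he x)
  have h1 := map_prodMap (Algebra.ofId ℂ (K →L[ℂ] K)) (fun j => (S j).vectorFunctional (h j)) x
  have h2 : Algebra.ofId ℂ (K →L[ℂ] K) (prodMap (fun j => (S j).vectorFunctional (h j)) x) = 0 :=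
    h1.trans h0.symm
  rw [← funext hf]
  exact (map_eq_zero_iff _ (FaithfulSMul.algebraMap_injective ℂ (K →L[ℂ] K))).1 h2

theorem inducedCones_eq_commutingCones (hι : ∀ j, IsUniversalCStarCover (S j) (ι j)) :
    inducedCones ι = commutingCones S := by
  funext n
  ext x
  constructor
  · intro hx K _ _ _ φ hφ hcomm
    -- The maximal tensor product is built from nonzero Hilbert spaces only, so `K = 0` is treated
    -- apart.
    rcases subsingleton_or_nontrivial K with hK | hK
    · exact .of_subsingleton _
    refine isMatrixPositive_map_prodMap_of_unital x (fun ψ hψ hψ1 hψc => ?_) φ hφ hcomm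
    obtain ⟨e, he⟩ := exists_commutingRep hι ψ hψ hψ1 hψc
    have h : (x.map (toMaxTensor ι)).map e = x.map (prodMap ψ) := by
      ext1 i j
      exact he _
    exact h ▸ IsMatrixPositive.map e hx
  · intro hx
    refine isMatrixPositive_of_eval _ fun ρ => ?_
    have hcp (j) : (S j).IsCompletelyPositive (ι j) := fun n y hy =>
      ((hι j).embedding.mem_cone_iff n y).1 hy
    have h : (x.map (toMaxTensor ι)).map ρ.eval =
        x.map (prodMap fun j => (ρ.π j).toAlgHom.toLinearMap ∘ₗ ι j) := by
      ext1 i j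
      exact ρ.eval_toMaxTensor _
    rw [h]
    exact hx ρ.K (fun j => (ρ.π j).toAlgHom.toLinearMap ∘ₗ ι j) (fun j => (hcp j).comp (ρ.π j))
      fun i j hij a b => ρ.commuting i j hij _ _

end Cover

end OpSys

theorem mainTheorem9 {k : ℕ} {H : Fin k → Type u} [∀ j, NormedAddCommGroup (H j)]
    [∀ j, InnerProductSpace ℂ (H j)] [∀ j, CompleteSpace (H j)]
    (S : ∀ j, OpSys.OperatorSystem (H j))
    (A : Fin k → Type u) [∀ j, CStarAlgebra (A j)] (ι : ∀ j, (S j).Carrier →ₗ[ℂ] A j)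
    (hι : ∀ j, OpSys.IsUniversalCStarCover (S j) (ι j)) :
    Function.Injective (OpSys.toMaxTensor ι) ∧
      OpSys.inducedCones ι = OpSys.commutingCones S :=
  ⟨OpSys.toMaxTensor_injective hι, OpSys.inducedCones_eq_commutingCones hι⟩
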